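/- For a topological space $T$ let $w(T)$ denote its weight, the least cardinality of a base for its topology, and let $\mathcal H(T)$ denote the lattice of closed subsets of $T$, viewed as a first-order structure for the language $\{\mathbf 0,\mathbf 1,\wedge,\vee\}$ of bounded lattices ($\mathbf 0=\emptyset$, $\mathbf 1=T$, $\wedge=\cap$, $\vee=\cup$). For a distributive lattice $L$ with $\mathbf 0$ and $\mathbf 1$, the Wallman space $wL$ is the set of all ultrafilters (maximal proper nonempty filters) on $L$, with the sets $\{u\in wL: a\in u\}$ ($a\in L$) as a base for the closed sets. A continuum in a Hausdorff space is a nonempty compact connected subset; a compact Hausdorff space is hereditarily indecomposable if, whenever two continua in it meet, one is contained in the other; a map is weakly confluent if every continuum in its range is the image of a continuum in its domain. Write $\dim$ for covering dimension ($\dim\emptyset=-1$). Theorem. Let $f:Y\to X$ be a continuous surjection between compact Hausdorff spaces. Then there are an elementary sublattice (elementary substructure) $D$ of $\mathcal H(Y)$ and continuous surjections $g:Y\to Z$ and $h:Z\to X$, where $Z=wD$ is the Wallman space of $D$, such that $Z$ is compact Hausdorff, $f=h\circ g$, and: 1. if $X$ is infinite then $w(Z)=w(X)$, and if $X$ is finite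 then $w(Z)\le\aleph_0$; 2. if $Y$ is hereditarily indecomposable then so is $Z$; 3. $\dim Z=\dim Y$; 4. if $f$ is weakly confluent then so is $h$. -/

import Mathlib

open FirstOrder TopologicalSpace Cardinal

universe u v

/-! ## The Wallman space of a bounded distributive lattice -/

/-- A (proper, nonempty) filter on a bounded lattice. -/
structure IsLatticeFilter {L : Type u} [DistribLattice L] [BoundedOrder L] (F : Set L) : Prop where
  nonempty : F.Nonempty
  bot_notMem : ⊥ ∉ F
  inf_mem : ∀ a ∈ F, ∀ b ∈ F, a ⊓ b ∈ F
  mem_of_le : ∀ a ∈ F, ∀ b, a ≤ b → b ∈ F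

/-- The Wallman space `wL`: its points are the ultrafilters (maximal filters) on `L`. -/
def WallmanSpace (L : Type u) [DistribLattice L] [BoundedOrder L] : Type u :=
  {F : Set L // Maximal IsLatticeFilter F}

/-- The set `{u ∈ wL : a ∈ u}`. -/
def WallmanSpace.basicClosed {L : Type u} [DistribLattice L] [BoundedOrder L] (a : L) :
    Set (WallmanSpace L) :=
  {p | a ∈ p.1}

/-- The topology on `wL` for which the sets `basicClosed a` form a base for the closed sets.
(The union of `basicClosed a` and `basicClosed b` is `basicClosed (a ⊔ b)`, because ultrafilters on
a distributive lattice are prime, so the complements below form a base for the open sets.) -/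
instance (L : Type u) [DistribLattice L] [BoundedOrder L] : TopologicalSpace (WallmanSpace L) :=
  TopologicalSpace.generateFrom (Set.range fun a : L => (WallmanSpace.basicClosed a)ᶜ)

/-! ## Lattices as first-order structures and elementary sublattices -/

/-- The function symbols of the language of bounded lattices. -/
inductive LatticeFunc : ℕ → Type
  | bot : LatticeFunc 0
  | top : LatticeFunc 0
  | inf : LatticeFunc 2
  | sup : LatticeFunc 2

/-- The first-order language of bounded lattices, with symbols for `⊥`, `⊤`, `⊓`, `⊔`. -/
def latticeLanguage : FirstOrder.Language.{0, 0} where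
  Functions := LatticeFunc
  Relations := fun _ => Empty

/-- The family of closed subsets of `Y` as a structure for the language of bounded lattices:
`⊥`, `⊤`, `⊓`, `⊔` are interpreted as `∅`, `Y`, intersection and union. -/
instance closedsStructure (Y : Type u) [TopologicalSpace Y] :
    latticeLanguage.Structure (Closeds Y) where
  funMap := fun {_} s => match s with
    | LatticeFunc.bot => fun _ => ⊥
    | LatticeFunc.top => fun _ => ⊤
    | LatticeFunc.inf => fun x => x 0 ⊓ x 1
    | LatticeFunc.sup => fun x => x 0 ⊔ x 1
  RelMap := fun r => r.elim

/-- An elementary sublattice of the lattice of closed subsets of `Y`. -/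
abbrev ElementarySublattice (Y : Type u) [TopologicalSpace Y] : Type u :=
  FirstOrder.Language.ElementarySubstructure latticeLanguage (Closeds Y)

namespace ElementarySublattice

variable {Y : Type u} [TopologicalSpace Y] (D : ElementarySublattice Y)

theorem bot_mem : (⊥ : Closeds Y) ∈ D :=
  D.toSubstructure.fun_mem (L := latticeLanguage) LatticeFunc.bot Fin.elim0 (fun i => i.elim0)

theorem top_mem : (⊤ : Closeds Y) ∈ D :=
  D.toSubstructure.fun_mem (L := latticeLanguage) LatticeFunc.top Fin.elim0 (fun i => i.elim0)

theorem inf_mem {a b : Closeds Y} (ha : a ∈ D) (hb : b ∈ D) : a ⊓ b ∈ D :=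
  D.toSubstructure.fun_mem (L := latticeLanguage) LatticeFunc.inf ![a, b]
    (fun i => by fin_cases i <;> assumption)

theorem sup_mem {a b : Closeds Y} (ha : a ∈ D) (hb : b ∈ D) : a ⊔ b ∈ D :=
  D.toSubstructure.fun_mem (L := latticeLanguage) LatticeFunc.sup ![a, b]
    (fun i => by fin_cases i <;> assumption)

/-- The lattice operations of an elementary sublattice are those of the closed sets of `Y`. -/
instance : DistribLattice D :=
  { Subtype.lattice (P := fun x : Closeds Y => x ∈ D) (fun _ _ => sup_mem D)
      (fun _ _ => inf_mem D) with
    le_sup_inf := fun x y z => le_sup_inf (x := x.1) (y := y.1) (z := z.1) }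

instance : BoundedOrder D where
  top := ⟨⊤, top_mem D⟩
  le_top := fun x => le_top (a := x.1)
  bot := ⟨⊥, bot_mem D⟩
  bot_le := fun x => bot_le (a := x.1)

end ElementarySublattice

/-! ## Topological notions -/

/-- The weight of a space: the least cardinality of a base for its topology. -/
noncomputable def topWeight (X : Type u) [TopologicalSpace X] : Cardinal.{u} :=
  sInf {c | ∃ B : Set (Set X), IsTopologicalBasis B ∧ #B = c}

/-- `C` is a (sub)continuum of `X`: a nonempty compact connected subset. -/
def IsContinuum {X : Type u} [TopologicalSpace X] (C : Set X) : Prop :=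
  IsCompact C ∧ IsConnected C

/-- A space is hereditarily indecomposable if, whenever two continua in it meet, one of them is
contained in the other. -/
def HereditarilyIndecomposable (X : Type u) [TopologicalSpace X] : Prop :=
  ∀ C D : Set X, IsContinuum C → IsContinuum D → (C ∩ D).Nonempty → C ⊆ D ∨ D ⊆ C

/-- A map is weakly confluent if every continuum in the range is the image of a continuum in the
domain. -/
def WeaklyConfluent {Y : Type u} {X : Type v} [TopologicalSpace Y] [TopologicalSpace X]
    (f : Y → X) : Prop :=
  ∀ C : Set X, IsContinuum C → ∃ K : Set Y, IsContinuum K ∧ f '' K = C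

/-- `U` is a finite open cover of `X`. -/
def IsFiniteOpenCover {X : Type u} [TopologicalSpace X] (U : Set (Set X)) : Prop :=
  U.Finite ∧ (∀ s ∈ U, IsOpen s) ∧ ⋃₀ U = Set.univ

/-- The covering dimension of a (normal) space: the least `d` such that every finite open cover has
a finite open refinement all of whose points lie in at most `d + 1` members of the refinement.
The value `⊥` stands for dimension `-1`, taken by the empty space only (note `⊥ + 1 = ⊥`), and `⊤`
stands for infinite dimension. -/
noncomputable def coveringDim (X : Type u) [TopologicalSpace X] : WithBot ℕ∞ :=
  sInf {d | ∀ U : Set (Set X), IsFiniteOpenCover U →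
    ∃ V : Set (Set X), IsFiniteOpenCover V ∧ (∀ s ∈ V, ∃ t ∈ U, s ⊆ t) ∧
      ∀ x : X, (({s ∈ V | x ∈ s}.encard : ℕ∞) : WithBot ℕ∞) ≤ d + 1}

/-! Choose a base for `X` of least size and apply downward Löwenheim–Skolem to get an elementary
sublattice `D` of size at most `max ℵ₀ (w(X))` that contains the preimage of the closure of every
basic set. Sending `y` to the unique ultrafilter on `D` that contains all members of `D` through `y`
is a continuous surjection `g` onto `Z = wD`: normality of the lattice, which is first-order and
hence inherited by `D`, gives the ultrafilter and continuity, and compactness of `Y` gives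
surjectivity. Distinct points of `X` have basic neighbourhoods with disjoint closures, so `g`
separates the fibres of `f`; thus `f` factors through `g`, and `h` is continuous because `g` is a
quotient map.

The weight of `Z` is at most the size of `D`, and a continuous surjection between compact Hausdorff
spaces does not raise infinite weight. Weak confluence passes to `h` by pushing continua forward
along `g`.

The other two properties are expressed in the lattice. Dimension is governed by `IsSwelling`, one
formula for each number of sets and each order; since a swelling and the lack of one both transfer
to `D`, and compactness lets closed sets of `Z` be replaced by elements of `D`, the two dimensions
agree (`hasSwellings_wallman_iff`). Hereditary indecomposability implies `HasChicanes` for the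
closed sets of a compact Hausdorff space, this condition descends to `D`, and it implies hereditary
indecomposability of the Wallman space when that is Hausdorff. -/

/-! ## First-order transfer between a space and an elementary sublattice -/

section Terms

variable {α : Type*} {Y : Type u} [TopologicalSpace Y]

/-- The term `s ⊓ t`. -/
def termInf (s t : latticeLanguage.Term α) : latticeLanguage.Term α :=
  Language.Functions.apply₂ (L := latticeLanguage) LatticeFunc.inf s t

/-- The term `s ⊔ t`. -/
def termSup (s t : latticeLanguage.Term α) : latticeLanguage.Term α :=
  Language.Functions.apply₂ (L := latticeLanguage) LatticeFunc.sup s t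

/-- The term `⊥`. -/
def termBot : latticeLanguage.Term α :=
  Language.Term.func (L := latticeLanguage) LatticeFunc.bot Fin.elim0

/-- The term `⊤`. -/
def termTop : latticeLanguage.Term α :=
  Language.Term.func (L := latticeLanguage) LatticeFunc.top Fin.elim0

@[simp]
theorem realize_termInf (s t : latticeLanguage.Term α) (x : α → Closeds Y) :
    (termInf s t).realize x = s.realize x ⊓ t.realize x := rfl

@[simp]
theorem realize_termSup (s t : latticeLanguage.Term α) (x : α → Closeds Y) :
    (termSup s t).realize x = s.realize x ⊔ t.realize x := rfl

@[simp]
theorem realize_termBot (x : α → Closeds Y) :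
    (termBot : latticeLanguage.Term α).realize x = ⊥ := rfl

@[simp]
theorem realize_termTop (x : α → Closeds Y) :
    (termTop : latticeLanguage.Term α).realize x = ⊤ := rfl

theorem exists_term_finset_inf {ι : Type*} (s : Finset ι) (t : ι → latticeLanguage.Term α) :
    ∃ r : latticeLanguage.Term α, ∀ x : α → Closeds Y,
      r.realize x = s.inf fun i => (t i).realize x := by
  classical
  induction s using Finset.induction_on with
  | empty => exact ⟨termTop, fun x => by simp⟩
  | insert i s _ ih =>
    obtain ⟨r, hr⟩ := ih
    exact ⟨termInf (t i) r, fun x => by simp [hr]⟩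

theorem exists_term_finset_sup {ι : Type*} (s : Finset ι) (t : ι → latticeLanguage.Term α) :
    ∃ r : latticeLanguage.Term α, ∀ x : α → Closeds Y,
      r.realize x = s.sup fun i => (t i).realize x := by
  classical
  induction s using Finset.induction_on with
  | empty => exact ⟨termBot, fun x => by simp⟩
  | insert i s _ ih =>
    obtain ⟨r, hr⟩ := ih
    exact ⟨termSup (t i) r, fun x => by simp [hr]⟩

end Terms

/-- `b` enlarges the family `a` to one with empty meet any `m + 1` members of which have join `⊤`.
In terms of complements: an open cover is shrunk to one of order at most `m`. -/
def IsSwelling {L : Type*} [DistribLattice L] [BoundedOrder L] {ι : Type*} [Fintype ι] (m : ℕ)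
    (a b : ι → L) : Prop :=
  (∀ i, a i ≤ b i) ∧ Finset.univ.inf b = ⊥ ∧ ∀ s : Finset ι, s.card = m + 1 → s.sup b = ⊤

/-- For fixed `k` and `m` only finitely many joins and meets occur, so a finite conjunction
suffices; the order, absent from the language, is written as `a ⊓ b = a`. -/
theorem exists_formula_isSwelling (Y : Type u) [TopologicalSpace Y] (k m : ℕ) :
    ∃ φ : latticeLanguage.Formula (Fin k ⊕ Fin k), ∀ a b : Fin k → Closeds Y,
      φ.Realize (Sum.elim a b) ↔ IsSwelling m a b := by
  obtain ⟨r, hr⟩ := exists_term_finset_inf (Y := Y) (Finset.univ : Finset (Fin k))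
    fun i => Language.Term.var (L := latticeLanguage) (Sum.inr i : Fin k ⊕ Fin k)
  choose t ht using fun s : Finset (Fin k) => exists_term_finset_sup (Y := Y) s
    fun i => Language.Term.var (L := latticeLanguage) (Sum.inr i : Fin k ⊕ Fin k)
  refine ⟨(Language.Formula.iInf fun i : Fin k =>
      (termInf (Language.Term.var (Sum.inl i)) (Language.Term.var (Sum.inr i))).equal
        (Language.Term.var (Sum.inl i))) ⊓ (r.equal termBot ⊓
      Language.Formula.iInf fun s : {s : Finset (Fin k) // s.card = m + 1} =>
        (t s).equal termTop), fun a b => ?_⟩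
  simp only [Language.Formula.realize_inf, Language.Formula.realize_iInf,
    Language.Formula.realize_equal, realize_termInf, hr, ht, Language.Term.realize_var,
    Sum.elim_inl, Sum.elim_inr, realize_termBot, realize_termTop, inf_eq_left, Subtype.forall]
  rfl

namespace ElementarySublattice

variable {Y : Type u} [TopologicalSpace Y] (D : ElementarySublattice Y)

theorem realize_coe_iff {α : Type*} (φ : latticeLanguage.Formula α) (x : α → D) :
    φ.Realize (fun i => (x i : Closeds Y)) ↔ φ.Realize x :=
  D.subtype.map_formula φ x

/-- Finitely many existential quantifiers can be absorbed into the formula, so elementarity moves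
the witnesses into `D`. -/
theorem exists_realize {α β : Type*} [Finite β] (φ : latticeLanguage.Formula (α ⊕ β)) (x : α → D)
    (h : ∃ y : β → Closeds Y, φ.Realize (Sum.elim (fun i => (x i : Closeds Y)) y)) :
    ∃ y : β → D, φ.Realize (Sum.elim (fun i => (x i : Closeds Y)) fun j => (y j : Closeds Y)) := by
  rw [← Language.Formula.realize_iExs, D.realize_coe_iff, Language.Formula.realize_iExs] at h
  obtain ⟨y, hy⟩ := h
  refine ⟨y, ?_⟩
  rw [← D.realize_coe_iff] at hy
  convert hy using 1
  ext (i | i) <;> rfl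

theorem exists_realize_of_isEmpty {β : Type*} [Finite β] (φ : latticeLanguage.Formula β)
    (h : ∃ y : β → Closeds Y, φ.Realize y) :
    ∃ y : β → D, φ.Realize fun j => (y j : Closeds Y) := by
  have := D.exists_realize (α := Empty) (φ.relabel Sum.inr) Empty.elim
    (by simpa [Language.Formula.realize_relabel, Function.comp_def] using h)
  simpa [Language.Formula.realize_relabel, Function.comp_def] using this

/-- The inclusion of an elementary sublattice. -/
def coeHom : BoundedLatticeHom D (Closeds Y) where
  toFun := Subtype.val
  map_sup' _ _ := rfl
  map_inf' _ _ := rfl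
  map_top' := rfl
  map_bot' := rfl

theorem coe_finset_inf {ι : Type*} (s : Finset ι) (a : ι → D) :
    ((s.inf a : D) : Closeds Y) = s.inf fun i => (a i : Closeds Y) :=
  map_finset_inf D.coeHom s a

theorem coe_finset_sup {ι : Type*} (s : Finset ι) (a : ι → D) :
    ((s.sup a : D) : Closeds Y) = s.sup fun i => (a i : Closeds Y) :=
  map_finset_sup D.coeHom s a

theorem isSwelling_coe_iff {ι : Type*} [Fintype ι] {m : ℕ} {a b : ι → D} :
    IsSwelling m (fun i => (a i : Closeds Y)) (fun i => (b i : Closeds Y)) ↔ IsSwelling m a b := by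
  have h1 : ((⊥ : D) : Closeds Y) = ⊥ := rfl
  have h2 : ((⊤ : D) : Closeds Y) = ⊤ := rfl
  simp only [IsSwelling, ← coe_finset_inf, ← coe_finset_sup, ← h1, ← h2, Subtype.coe_inj,
    Subtype.coe_le_coe]

theorem exists_isSwelling {k m : ℕ} (a : Fin k → D)
    (h : ∃ b : Fin k → Closeds Y, IsSwelling m (fun i => (a i : Closeds Y)) b) :
    ∃ b : Fin k → D, IsSwelling m a b := by
  obtain ⟨φ, hφ⟩ := exists_formula_isSwelling Y k m
  obtain ⟨b, hb⟩ := D.exists_realize φ a (by simpa only [hφ] using h)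
  exact ⟨b, isSwelling_coe_iff D |>.1 ((hφ _ _).1 hb)⟩

/-- Nonexistence of a swelling is also first-order, so a counterexample can be found inside `D`.
This prevents the dimension from dropping. -/
theorem exists_not_isSwelling {k m : ℕ}
    (h : ∃ a : Fin k → Closeds Y, Finset.univ.inf a = ⊥ ∧ ∀ b, ¬ IsSwelling m a b) :
    ∃ a : Fin k → D, Finset.univ.inf a = ⊥ ∧ ∀ b, ¬ IsSwelling m a b := by
  obtain ⟨φ, hφ⟩ := exists_formula_isSwelling Y k m
  obtain ⟨r, hr⟩ := exists_term_finset_inf (Y := Y) (Finset.univ : Finset (Fin k))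
    fun i => Language.Term.var (L := latticeLanguage) i
  have key : ∀ a : Fin k → Closeds Y, (r.equal termBot ⊓ (φ.iExs (Fin k)).not).Realize a ↔
      Finset.univ.inf a = ⊥ ∧ ∀ b, ¬ IsSwelling m a b := by
    intro a
    simp [Language.Formula.realize_iExs, hφ, hr]
  obtain ⟨a, ha⟩ := D.exists_realize_of_isEmpty (r.equal termBot ⊓ (φ.iExs (Fin k)).not)
    (by simpa only [key] using h)
  obtain ⟨ha, hb⟩ := (key _).1 ha
  refine ⟨a, Subtype.ext ((coe_finset_inf D _ _).trans ha), fun b hab => ?_⟩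
  exact hb _ ((isSwelling_coe_iff D).2 hab)

/-- An elementary sublattice of a normal space is a normal lattice. -/
theorem normal [NormalSpace Y] (a b : D) (hab : a ⊓ b = ⊥) :
    ∃ c d : D, c ⊔ d = ⊤ ∧ a ⊓ c = ⊥ ∧ b ⊓ d = ⊥ := by
  let φ : latticeLanguage.Formula (Fin 2 ⊕ Fin 2) :=
    (termSup (.var (.inr 0)) (.var (.inr 1))).equal termTop ⊓
      ((termInf (.var (.inl 0)) (.var (.inr 0))).equal termBot ⊓
        (termInf (.var (.inl 1)) (.var (.inr 1))).equal termBot)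
  obtain ⟨y, hy⟩ := D.exists_realize φ ![a, b] (by
    have hd : Disjoint ((a : Closeds Y) : Set Y) ((b : Closeds Y) : Set Y) := by
      rw [Set.disjoint_iff_inter_eq_empty]
      exact congrArg (fun e : D => ((e : Closeds Y) : Set Y)) hab
    obtain ⟨U, V, hU, hV, haU, hbV, hUV⟩ := normal_separation (a : Closeds Y).isClosed
      (b : Closeds Y).isClosed hd
    refine ⟨![⟨Uᶜ, hU.isClosed_compl⟩, ⟨Vᶜ, hV.isClosed_compl⟩], ?_⟩
    simp only [φ, Language.Formula.realize_inf, Language.Formula.realize_equal, realize_termInf,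
      realize_termSup, realize_termBot, realize_termTop, Language.Term.realize_var, Sum.elim_inl,
      Sum.elim_inr, Matrix.cons_val_zero, Matrix.cons_val_one]
    refine ⟨?_, ?_, ?_⟩ <;> apply SetLike.coe_injective
    · change Uᶜ ∪ Vᶜ = Set.univ
      rw [← Set.compl_inter, hUV.inter_eq, Set.compl_empty]
    · change ((a : Closeds Y) : Set Y) ∩ Uᶜ = ∅
      rwa [← Set.sdiff_eq, Set.sdiff_eq_empty]
    · change ((b : Closeds Y) : Set Y) ∩ Vᶜ = ∅
      rwa [← Set.sdiff_eq, Set.sdiff_eq_empty])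
  simp only [φ, Language.Formula.realize_inf, Language.Formula.realize_equal, realize_termInf,
    realize_termSup, realize_termBot, realize_termTop, Language.Term.realize_var, Sum.elim_inl,
    Sum.elim_inr, Matrix.cons_val_zero, Matrix.cons_val_one] at hy
  exact ⟨y 0, y 1, Subtype.ext hy.1, Subtype.ext hy.2.1, Subtype.ext hy.2.2⟩

/-- Elements of an elementary sublattice of a `T₁` space are separated from `⊤`. -/
theorem exists_ne_bot_inf_eq_bot [T1Space Y] (a : D) (ha : a ≠ ⊤) :
    ∃ d : D, d ≠ ⊥ ∧ a ⊓ d = ⊥ := by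
  let φ : latticeLanguage.Formula (Unit ⊕ Unit) :=
    ((Language.Term.var (.inr ())).equal termBot).not ⊓
      (termInf (.var (.inl ())) (.var (.inr ()))).equal termBot
  obtain ⟨y, hy⟩ := D.exists_realize φ (fun _ => a) (by
    have : ((a : Closeds Y) : Set Y) ≠ Set.univ := fun h =>
      ha (Subtype.ext (SetLike.coe_injective h))
    obtain ⟨p, hp⟩ := (Set.ne_univ_iff_exists_notMem _).1 this
    -- In `Closeds Y` the witness is a point outside `a`, closed by `T₁`.
    refine ⟨fun _ => ⟨{p}, isClosed_singleton⟩, ?_⟩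
    simp only [φ, Language.Formula.realize_inf, Language.Formula.realize_not,
      Language.Formula.realize_equal, realize_termInf,
      realize_termBot, Language.Term.realize_var, Sum.elim_inl, Sum.elim_inr]
    refine ⟨fun h => ?_, ?_⟩
    · exact Set.singleton_ne_empty p (congrArg (fun e : Closeds Y => (e : Set Y)) h)
    · apply SetLike.coe_injective
      exact Set.inter_singleton_eq_empty.2 hp)
  simp only [φ, Language.Formula.realize_inf, Language.Formula.realize_not,
    Language.Formula.realize_equal, realize_termInf,
    realize_termBot, Language.Term.realize_var, Sum.elim_inl, Sum.elim_inr] at hy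
  exact ⟨y (), fun h => hy.1 (congrArg Subtype.val h), Subtype.ext hy.2⟩

end ElementarySublattice

/-- Every pliand foursome in the lattice has a crooked division: the lattice-theoretic form of
hereditary indecomposability. -/
def HasChicanes (L : Type*) [DistribLattice L] [BoundedOrder L] : Prop :=
  ∀ a b c d : L, a ⊓ b = ⊥ → a ⊓ c = ⊥ → b ⊓ d = ⊥ →
    ∃ x y z : L, x ⊔ y ⊔ z = ⊤ ∧ a ≤ x ∧ b ≤ z ∧ x ⊓ z = ⊥ ∧ x ⊓ y ⊓ d = ⊥ ∧ y ⊓ z ⊓ c = ⊥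

theorem ElementarySublattice.hasChicanes {Y : Type u} [TopologicalSpace Y]
    (D : ElementarySublattice Y) (h : HasChicanes (Closeds Y)) : HasChicanes D := by
  intro a b c d hab hac hbd
  let X : Fin 3 → latticeLanguage.Term (Fin 4 ⊕ Fin 3) := fun i => .var (.inr i)
  let A : Fin 4 → latticeLanguage.Term (Fin 4 ⊕ Fin 3) := fun i => .var (.inl i)
  let φ : latticeLanguage.Formula (Fin 4 ⊕ Fin 3) :=
    (termSup (termSup (X 0) (X 1)) (X 2)).equal termTop ⊓ ((termInf (A 0) (X 0)).equal (A 0) ⊓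
      ((termInf (A 1) (X 2)).equal (A 1) ⊓ ((termInf (X 0) (X 2)).equal termBot ⊓
      ((termInf (termInf (X 0) (X 1)) (A 3)).equal termBot ⊓
      (termInf (termInf (X 1) (X 2)) (A 2)).equal termBot))))
  have key : ∀ (p : Fin 4 → Closeds Y) (q : Fin 3 → Closeds Y), φ.Realize (Sum.elim p q) ↔
      q 0 ⊔ q 1 ⊔ q 2 = ⊤ ∧ p 0 ≤ q 0 ∧ p 1 ≤ q 2 ∧ q 0 ⊓ q 2 = ⊥ ∧ q 0 ⊓ q 1 ⊓ p 3 = ⊥ ∧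
        q 1 ⊓ q 2 ⊓ p 2 = ⊥ := by
    intro p q
    simp only [φ, X, A, Language.Formula.realize_inf, Language.Formula.realize_equal,
      realize_termInf, realize_termSup, realize_termBot, realize_termTop,
      Language.Term.realize_var, Sum.elim_inl, Sum.elim_inr, inf_eq_left]
  obtain ⟨y, hy⟩ := D.exists_realize φ ![a, b, c, d] (by
    obtain ⟨x, y, z, hxyz⟩ := h a b c d (congrArg Subtype.val hab) (congrArg Subtype.val hac)
      (congrArg Subtype.val hbd)
    exact ⟨![x, y, z], (key _ _).2 hxyz⟩)
  obtain ⟨h1, h2, h3, h4, h5, h6⟩ := (key _ _).1 hy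
  exact ⟨y 0, y 1, y 2, Subtype.ext h1, h2, h3, Subtype.ext h4, Subtype.ext h5, Subtype.ext h6⟩

/-! ## The Wallman space of a lattice -/

namespace WallmanSpace

variable {L : Type u} [DistribLattice L] [BoundedOrder L]

theorem eq_of_subset (p : WallmanSpace L) {F : Set L} (hF : IsLatticeFilter F) (h : p.1 ⊆ F) :
    p.1 = F :=
  h.antisymm (p.2.2 hF h)

theorem top_mem (p : WallmanSpace L) : ⊤ ∈ p.1 :=
  let ⟨a, ha⟩ := p.2.1.nonempty
  p.2.1.mem_of_le a ha ⊤ le_top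

/-- Otherwise `p` and `a` would generate a proper filter, against maximality. -/
theorem exists_inf_eq_bot (p : WallmanSpace L) {a : L} (ha : a ∉ p.1) : ∃ b ∈ p.1, a ⊓ b = ⊥ := by
  by_contra! hne
  have hF : IsLatticeFilter {c : L | ∃ b ∈ p.1, a ⊓ b ≤ c} := by
    refine ⟨⟨a, ⊤, p.top_mem, inf_le_left⟩, ?_, ?_, ?_⟩
    · rintro ⟨b, hb, h⟩
      exact hne b hb (le_bot_iff.1 h)
    · rintro c ⟨b, hb, h⟩ c' ⟨b', hb', h'⟩
      exact ⟨b ⊓ b', p.2.1.inf_mem b hb b' hb', le_inf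
        ((inf_le_inf_left a inf_le_left).trans h) ((inf_le_inf_left a inf_le_right).trans h')⟩
    · rintro c ⟨b, hb, h⟩ d hcd
      exact ⟨b, hb, h.trans hcd⟩
  have heq := p.eq_of_subset hF fun b hb => ⟨b, hb, inf_le_right⟩
  exact ha (heq ▸ ⟨⊤, p.top_mem, inf_le_left⟩)

theorem inf_ne_bot (p : WallmanSpace L) {a b : L} (ha : a ∈ p.1) (hb : b ∈ p.1) : a ⊓ b ≠ ⊥ :=
  fun h => p.2.1.bot_notMem (h ▸ p.2.1.inf_mem a ha b hb)

theorem inf_mem_iff (p : WallmanSpace L) {a b : L} : a ⊓ b ∈ p.1 ↔ a ∈ p.1 ∧ b ∈ p.1 :=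
  ⟨fun h => ⟨p.2.1.mem_of_le _ h _ inf_le_left, p.2.1.mem_of_le _ h _ inf_le_right⟩,
    fun h => p.2.1.inf_mem _ h.1 _ h.2⟩

theorem sup_mem_iff (p : WallmanSpace L) {a b : L} : a ⊔ b ∈ p.1 ↔ a ∈ p.1 ∨ b ∈ p.1 := by
  refine ⟨fun h => ?_, fun h => h.elim (fun h => p.2.1.mem_of_le _ h _ le_sup_left)
    fun h => p.2.1.mem_of_le _ h _ le_sup_right⟩
  by_contra! hab
  obtain ⟨c, hc, hac⟩ := p.exists_inf_eq_bot hab.1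
  obtain ⟨d, hd, hbd⟩ := p.exists_inf_eq_bot hab.2
  refine p.inf_ne_bot h (p.2.1.inf_mem c hc d hd) ?_
  rw [inf_sup_right, ← inf_assoc, hac, bot_inf_eq, bot_sup_eq, inf_comm c d, ← inf_assoc, hbd,
    bot_inf_eq]

theorem isClosed_basicClosed (a : L) : IsClosed (basicClosed a) :=
  isOpen_compl_iff.1 (isOpen_generateFrom_of_mem ⟨a, rfl⟩)

/-- The homomorphism from a lattice into the closed sets of its Wallman space. -/
def closedsHom : BoundedLatticeHom L (Closeds (WallmanSpace L)) where
  toFun a := ⟨basicClosed a, isClosed_basicClosed a⟩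
  map_sup' _ _ := SetLike.coe_injective (Set.ext fun p => p.sup_mem_iff)
  map_inf' _ _ := SetLike.coe_injective (Set.ext fun p => p.inf_mem_iff)
  map_top' := SetLike.coe_injective (Set.eq_univ_of_forall fun p => p.top_mem)
  map_bot' := SetLike.coe_injective (Set.eq_empty_of_forall_notMem fun p => p.2.1.bot_notMem)

theorem isTopologicalBasis_compl_basicClosed :
    IsTopologicalBasis (Set.range fun a : L => (basicClosed a)ᶜ) := by
  have h := isTopologicalBasis_of_subbasis_of_inter
    (r := Set.range fun a : L => (basicClosed a)ᶜ) rfl (by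
      rintro _ ⟨a, rfl⟩ _ ⟨b, rfl⟩
      refine ⟨a ⊔ b, ?_⟩
      simp only [← Set.compl_union]
      congr 1
      exact Set.ext fun p => p.sup_mem_iff)
  rwa [Set.insert_eq_of_mem] at h
  exact ⟨⊥, Set.eq_univ_of_forall fun p => p.2.1.bot_notMem⟩

theorem exists_closedsHom_of_notMem {C : Set (WallmanSpace L)} (hC : IsClosed C)
    {p : WallmanSpace L} (hp : p ∉ C) : ∃ a : L, p ∉ closedsHom a ∧ C ⊆ closedsHom a := by
  obtain ⟨_, ⟨a, rfl⟩, hpa, ha⟩ := isTopologicalBasis_compl_basicClosed.exists_subset_of_mem_open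
    (show p ∈ Cᶜ from hp) hC.isOpen_compl
  exact ⟨a, hpa, Set.compl_subset_compl.1 ha⟩

theorem exists_inf_eq_bot_of_ne {p q : WallmanSpace L} (h : p ≠ q) :
    ∃ a ∈ p.1, ∃ b ∈ q.1, a ⊓ b = ⊥ := by
  have : ¬ p.1 ⊆ q.1 := fun hs => h (Subtype.ext (p.eq_of_subset q.2.1 hs))
  obtain ⟨a, hap, haq⟩ := Set.not_subset.1 this
  obtain ⟨b, hb, hab⟩ := q.exists_inf_eq_bot haq
  exact ⟨a, hap, b, hb, hab⟩

theorem t2Space_of_normal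
    (hL : ∀ a b : L, a ⊓ b = ⊥ → ∃ c d : L, c ⊔ d = ⊤ ∧ a ⊓ c = ⊥ ∧ b ⊓ d = ⊥) :
    T2Space (WallmanSpace L) := by
  refine ⟨fun p q hpq => ?_⟩
  obtain ⟨a, ha, b, hb, hab⟩ := exists_inf_eq_bot_of_ne hpq
  obtain ⟨c, d, hcd, hac, hbd⟩ := hL a b hab
  refine ⟨(basicClosed c)ᶜ, (basicClosed d)ᶜ, (isClosed_basicClosed c).isOpen_compl,
    (isClosed_basicClosed d).isOpen_compl, fun hc => p.inf_ne_bot ha hc hac,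
    fun hd => q.inf_ne_bot hb hd hbd, ?_⟩
  rw [Set.disjoint_left]
  intro r hrc hrd
  exact (r.sup_mem_iff.1 (hcd ▸ r.top_mem : c ⊔ d ∈ r.1)).elim hrc hrd

/-- Closed sets of a compact Wallman space with empty intersection can be enlarged to basic
closed sets with empty intersection. -/
theorem exists_le_closedsHom [CompactSpace (WallmanSpace L)] {ι : Type*} [Fintype ι]
    (B : ι → Closeds (WallmanSpace L)) (hB : Finset.univ.inf B = ⊥) :
    ∃ c : ι → L, (∀ i, B i ≤ closedsHom (c i)) ∧
      Finset.univ.inf (fun i => closedsHom (c i)) = ⊥ := by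
  classical
  have h1 : ∀ p : WallmanSpace L, ∃ i, ∃ a : L, p ∉ closedsHom a ∧ B i ≤ closedsHom a := by
    intro p
    by_contra! hne
    have hp : p ∈ ((Finset.univ.inf B : Closeds (WallmanSpace L)) : Set (WallmanSpace L)) := by
      rw [Closeds.coe_finset_inf, Finset.inf_eq_iInf]
      refine Set.mem_iInter₂.2 fun i _ => ?_
      by_contra hpi
      obtain ⟨a, ha, ha'⟩ := exists_closedsHom_of_notMem (B i).isClosed hpi
      exact hne i a ha ha'
    rw [hB] at hp
    exact hp
  choose i a ha hBa using h1
  obtain ⟨t, ht⟩ := isCompact_univ.elim_finite_subfamily_closed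
    (fun p => (closedsHom (a p) : Set (WallmanSpace L))) (fun p => (closedsHom (a p)).isClosed)
    (by
      rw [Set.univ_inter]
      exact Set.eq_empty_of_forall_notMem fun p hp => ha p (Set.mem_iInter.1 hp p))
  -- Each selected `a p` lies above `B (i p)`; meeting those with the same index gives one element
  -- per index.
  refine ⟨fun j => (t.filter fun p => i p = j).inf a, fun j => ?_, ?_⟩
  · rw [map_finset_inf]
    refine Finset.le_inf fun p hp => ?_
    rw [← (Finset.mem_filter.1 hp).2]
    exact hBa p
  · rw [eq_bot_iff]
    intro q hq
    rw [Set.univ_inter] at ht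
    change q ∈ (∅ : Set (WallmanSpace L))
    rw [← ht]
    refine Set.mem_iInter₂.2 fun p hp => ?_
    have h2 : (Finset.univ.inf fun j => closedsHom ((t.filter fun p => i p = j).inf a)) ≤
        closedsHom (a p) :=
      (Finset.inf_le (Finset.mem_univ (i p))).trans
        (OrderHomClass.mono closedsHom (Finset.inf_le (Finset.mem_filter.2 ⟨hp, rfl⟩)))
    exact h2 hq

end WallmanSpace

/-! ## The quotient map onto the Wallman space of an elementary sublattice -/

namespace ElementarySublattice

variable {Y : Type u} [TopologicalSpace Y] (D : ElementarySublattice Y)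

theorem inf_eq_bot_iff {a b : D} :
    a ⊓ b = ⊥ ↔ ∀ y, y ∈ (a : Closeds Y) → y ∉ (b : Closeds Y) := by
  rw [← Subtype.coe_inj, ← SetLike.coe_set_eq]
  change ((a : Closeds Y) : Set Y) ∩ ((b : Closeds Y) : Set Y) = ∅ ↔ _
  rw [← Set.disjoint_iff_inter_eq_empty, Set.disjoint_left]
  rfl

variable [NormalSpace Y]

/-- The unique ultrafilter that contains all elements of `D` to which `y` belongs. -/
def toWallman (y : Y) : WallmanSpace D :=
  ⟨{a | ∀ b : D, y ∈ (b : Closeds Y) → a ⊓ b ≠ ⊥}, by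
    constructor
    · refine ⟨⟨⊤, fun b hb h => ?_⟩, fun h => ?_, ?_, fun a ha b hab c hc h => ?_⟩
      · exact (D.inf_eq_bot_iff.1 h) y (Set.mem_univ y) hb
      · exact h ⊤ (Set.mem_univ y) (bot_inf_eq _)
      · intro a ha a' ha' b hb h
        -- The point `y` lies in `c` or in `d`; intersecting `b` with that one gives a set through
        -- `y` that misses `a` or `a'`.
        obtain ⟨c, d, hcd, hac, had⟩ := D.normal (a ⊓ b) (a' ⊓ b) (by
          rw [← h]
          exact inf_inf_distrib_right a a' b |>.symm)
        have hy : y ∈ ((c ⊔ d : D) : Closeds Y) := by rw [hcd]; exact Set.mem_univ y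
        rcases hy with hy | hy
        · exact ha (b ⊓ c) ⟨hb, hy⟩ (by rw [← inf_assoc, hac])
        · exact ha' (b ⊓ d) ⟨hb, hy⟩ (by rw [← inf_assoc, had])
      · exact ha c hc (le_bot_iff.1 ((inf_le_inf_right c hab).trans h.le))
    · intro F hF hsub a ha b hb h
      have hbF : b ∈ F := hsub fun c hc h' => D.inf_eq_bot_iff.1 h' y hb hc
      exact hF.bot_notMem (h ▸ hF.inf_mem a ha b hbF)⟩

theorem mem_toWallman {y : Y} {a : D} :
    a ∈ (D.toWallman y).1 ↔ ∀ b : D, y ∈ (b : Closeds Y) → a ⊓ b ≠ ⊥ := Iff.rfl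

theorem mem_toWallman_of_mem {y : Y} {a : D} (h : y ∈ (a : Closeds Y)) :
    a ∈ (D.toWallman y).1 :=
  fun _ hb h' => D.inf_eq_bot_iff.1 h' y h hb

theorem continuous_toWallman : Continuous D.toWallman := by
  refine continuous_generateFrom_iff.2 ?_
  rintro _ ⟨a, rfl⟩
  refine isOpen_iff_forall_mem_open.2 fun y hy => ?_
  have hy' : a ∉ (D.toWallman y).1 := hy
  rw [mem_toWallman] at hy'
  push Not at hy'
  obtain ⟨b, hb, hab⟩ := hy'
  obtain ⟨c, d, hcd, hac, hbd⟩ := D.normal a b hab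
  refine ⟨((d : Closeds Y) : Set Y)ᶜ, fun z hz hza => ?_, (d : Closeds Y).isClosed.isOpen_compl,
    D.inf_eq_bot_iff.1 hbd y hb⟩
  have hzcd : z ∈ ((c ⊔ d : D) : Closeds Y) := by rw [hcd]; exact Set.mem_univ z
  exact hza c (hzcd.resolve_right hz) hac

/-- The members of an ultrafilter have the finite intersection property, and any point common to all
of them is mapped to it. -/
theorem surjective_toWallman [CompactSpace Y] : Function.Surjective D.toWallman := by
  intro p
  have hne : (Set.univ ∩ ⋂ a : p.1, ((a.1 : Closeds Y) : Set Y)).Nonempty := by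
    refine isCompact_univ.inter_iInter_nonempty _ (fun a => (a.1 : Closeds Y).isClosed) fun t => ?_
    have key : ∃ c ∈ p.1, ∀ a ∈ t, c ≤ a.1 := by
      classical
      induction t using Finset.induction_on with
      | empty => exact ⟨⊤, p.top_mem, by simp⟩
      | insert a t _ ih =>
        obtain ⟨c, hc, hct⟩ := ih
        refine ⟨a.1 ⊓ c, p.2.1.inf_mem _ a.2 _ hc, fun b hb => ?_⟩
        rcases Finset.mem_insert.1 hb with rfl | hb
        · exact inf_le_left
        · exact inf_le_right.trans (hct b hb)
    obtain ⟨c, hc, hct⟩ := key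
    rw [Set.univ_inter]
    by_contra hemp
    refine p.inf_ne_bot hc p.top_mem (D.inf_eq_bot_iff.2 fun y hy _ => hemp ⟨y, ?_⟩)
    exact Set.mem_iInter₂.2 fun a ha => hct a ha hy
  obtain ⟨y, -, hy⟩ := hne
  refine ⟨y, Subtype.ext (p.eq_of_subset (D.toWallman y).2.1 fun a ha => ?_).symm⟩
  exact D.mem_toWallman_of_mem (Set.mem_iInter.1 hy ⟨a, ha⟩)

theorem compactSpace_wallman [CompactSpace Y] : CompactSpace (WallmanSpace D) :=
  D.surjective_toWallman.compactSpace D.continuous_toWallman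

theorem t2Space_wallman : T2Space (WallmanSpace D) :=
  WallmanSpace.t2Space_of_normal D.normal

/-- A point of `a` would give an ultrafilter containing `a`. Reflecting `⊥` and `⊤` is what brings
swellings back from the Wallman space. -/
theorem eq_bot_of_closedsHom {a : D} (h : WallmanSpace.closedsHom a = ⊥) : a = ⊥ := by
  have : a ⊓ ⊤ = ⊥ := D.inf_eq_bot_iff.2 fun y hy _ => by
    have hy' : D.toWallman y ∈ WallmanSpace.closedsHom a := D.mem_toWallman_of_mem hy
    rw [h] at hy'
    exact hy'
  rwa [inf_top_eq] at this

theorem eq_top_of_closedsHom [T1Space Y] {a : D} (h : WallmanSpace.closedsHom a = ⊤) :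
    a = ⊤ := by
  by_contra hne
  obtain ⟨d, hd, had⟩ := D.exists_ne_bot_inf_eq_bot a hne
  refine hd (D.eq_bot_of_closedsHom ?_)
  rw [← top_inf_eq (WallmanSpace.closedsHom d), ← h, ← map_inf, had, map_bot]

end ElementarySublattice

/-! ## Hereditary indecomposability -/

section HereditarilyIndecomposable

/-- In a compact Hausdorff space a component is the intersection of the clopen sets around it;
compactness of `A` leaves finitely many of them. -/
theorem exists_isClopen_of_disjoint_connectedComponent {K : Type*} [TopologicalSpace K]
    [CompactSpace K] [T2Space K] {A : Set K} (hA : IsClosed A) {x : K}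
    (hx : Disjoint (connectedComponent x) A) : ∃ P : Set K, IsClopen P ∧ A ⊆ P ∧ x ∉ P := by
  obtain ⟨t, ht⟩ := hA.isCompact.elim_finite_subfamily_closed
    (fun s : {s : Set K // IsClopen s ∧ x ∈ s} => (s : Set K)) (fun s => s.2.1.1) (by
      rw [← connectedComponent_eq_iInter_isClopen, Set.inter_comm]
      exact hx.inter_eq)
  refine ⟨(⋂ s ∈ t, (s : Set K))ᶜ, (t.finite_toSet.isClopen_biInter fun s _ => s.2.1).compl,
    fun a ha h => ?_, fun h => h (Set.mem_iInter₂.2 fun s _ => s.2.2)⟩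
  rw [Set.eq_empty_iff_forall_notMem] at ht
  exact ht a ⟨ha, h⟩

/-- Away from `closure V`, a relatively open subset of `Vᶜ` is open in `Y`, so it has no boundary
points there. -/
theorem inter_closure_compl_subset_closure {Y : Type*} [TopologicalSpace Y] {V F : Set Y}
    (P : Set (Vᶜ : Set Y)) (hP : IsClopen P) (hF : F = Subtype.val '' P) : F ∩ closure Fᶜ ⊆ closure V := by
  subst hF
  rintro _ ⟨⟨x, hx, rfl⟩, hxF⟩
  by_contra hxV
  obtain ⟨W, hW, hWP⟩ := isOpen_induced_iff.1 hP.isOpen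
  have hxW : x.1 ∈ W := by
    rw [← hWP] at hx
    exact hx
  obtain ⟨y, ⟨hyW, hyV⟩, hyF⟩ := mem_closure_iff.1 hxF (W ∩ (closure V)ᶜ)
    (hW.inter isClosed_closure.isOpen_compl) ⟨hxW, hxV⟩
  exact hyF ⟨⟨y, fun h => hyV (subset_closure h)⟩, hWP ▸ hyW, rfl⟩

variable {Y : Type u} [TopologicalSpace Y] [CompactSpace Y] [T2Space Y]

theorem exists_isContinuum_of_forall_isClopen {K A : Set Y} (hK : IsClosed K) (hA : IsClosed A)
    {x : Y} (hx : ∀ P : Set K, IsClopen P → Subtype.val ⁻¹' A ⊆ P → x ∈ Subtype.val '' P) :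
    ∃ C ⊆ K, IsContinuum C ∧ x ∈ C ∧ (C ∩ A).Nonempty := by
  have : CompactSpace K := isCompact_iff_compactSpace.1 hK.isCompact
  obtain ⟨x, -, rfl⟩ := hx Set.univ isClopen_univ (Set.subset_univ _)
  refine ⟨Subtype.val '' connectedComponent x, Subtype.coe_image_subset _ _,
    ⟨isClosed_connectedComponent.isCompact.image continuous_subtype_val,
      isConnected_connectedComponent.image _ continuous_subtype_val.continuousOn⟩,
    ⟨x, mem_connectedComponent, rfl⟩, ?_⟩
  by_contra hne
  obtain ⟨P, hP, hAP, hxP⟩ := exists_isClopen_of_disjoint_connectedComponent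
    (hA.preimage continuous_subtype_val) (x := x)
    (Set.disjoint_left.2 fun z hz hzA => hne ⟨z, ⟨z, hz, rfl⟩, hzA⟩)
  obtain ⟨z, hz, hzx⟩ := hx P hP hAP
  exact hxP (Subtype.ext hzx ▸ hz)

/-- In a hereditarily indecomposable space, clopen neighbourhoods of `A` in `K` and of `B` in `L`
can be chosen disjoint when `B` misses `K` and `A` misses `L`. -/
theorem HereditarilyIndecomposable.exists_disjoint_isClopen (h : HereditarilyIndecomposable Y)
    {K L A B : Set Y} (hK : IsClosed K) (hL : IsClosed L) (hA : IsClosed A) (hB : IsClosed B)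
    (hAL : Disjoint A L) (hBK : Disjoint B K) :
    ∃ (P : Set K) (Q : Set L), IsClopen P ∧ IsClopen Q ∧ Subtype.val ⁻¹' A ⊆ P ∧
      Subtype.val ⁻¹' B ⊆ Q ∧ Disjoint (Subtype.val '' P) (Subtype.val '' Q) := by
  let I := {P : Set K // IsClopen P ∧ Subtype.val ⁻¹' A ⊆ P} ×
    {Q : Set L // IsClopen Q ∧ Subtype.val ⁻¹' B ⊆ Q}
  let F : I → Set Y := fun i => (Subtype.val '' i.1.1) ∩ (Subtype.val '' i.2.1)
  have hne : Nonempty I := ⟨⟨Set.univ, isClopen_univ, Set.subset_univ _⟩,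
    ⟨Set.univ, isClopen_univ, Set.subset_univ _⟩⟩
  obtain ⟨i, hi⟩ := isCompact_univ.elim_directed_family_closed F
    (fun i => (hK.isClosedMap_subtype_val _ i.1.2.1.1).inter
      (hL.isClosedMap_subtype_val _ i.2.2.1.1)) (by
      -- A point `x` in every intersection would lie on a continuum in `K` meeting `A` and on one in
      -- `L` meeting `B`. One contains the other, so `A` meets `L` or `B` meets `K`.
      rw [Set.univ_inter]
      refine Set.eq_empty_of_forall_notMem fun x hx => ?_
      rw [Set.mem_iInter] at hx
      obtain ⟨C, hCK, hC, hxC, hCA⟩ := exists_isContinuum_of_forall_isClopen hK hA (x := x)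
        fun P hP hAP => (hx ⟨⟨P, hP, hAP⟩, hne.some.2⟩).1
      obtain ⟨E, hEL, hE, hxE, hEB⟩ := exists_isContinuum_of_forall_isClopen hL hB (x := x)
        fun Q hQ hBQ => (hx ⟨hne.some.1, ⟨Q, hQ, hBQ⟩⟩).2
      obtain ⟨a, haC, haA⟩ := hCA
      obtain ⟨b, hbE, hbB⟩ := hEB
      rcases h C E hC hE ⟨x, hxC, hxE⟩ with hs | hs
      · exact Set.disjoint_left.1 hAL haA (hEL (hs haC))
      · exact Set.disjoint_left.1 hBK hbB (hCK (hs hbE)))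
    (by
      rintro ⟨P, Q⟩ ⟨P', Q'⟩
      refine ⟨⟨⟨P.1 ∩ P'.1, P.2.1.inter P'.2.1, Set.subset_inter P.2.2 P'.2.2⟩,
        ⟨Q.1 ∩ Q'.1, Q.2.1.inter Q'.2.1, Set.subset_inter Q.2.2 Q'.2.2⟩⟩, ?_, ?_⟩
      · exact Set.inter_subset_inter (Set.image_mono Set.inter_subset_left)
          (Set.image_mono Set.inter_subset_left)
      · exact Set.inter_subset_inter (Set.image_mono Set.inter_subset_right)
          (Set.image_mono Set.inter_subset_right))
  rw [Set.univ_inter] at hi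
  exact ⟨i.1.1, i.2.1, i.1.2.1, i.2.2.1, i.1.2.2, i.2.2.2, Set.disjoint_iff_inter_eq_empty.2 hi⟩

/-- Take neighbourhoods `U` of `a` and `V` of `b` with closures missing `b ∪ c` and `a ∪ d`.
Disjoint clopen parts of `Vᶜ` around `a` and of `Uᶜ` around `b` serve as `x` and `z`, and the
closure of the rest as `y`; then `x` and `y` meet only in `closure V`, off `d`, and `y` and `z` only
in `closure U`, off `c`. -/
theorem HereditarilyIndecomposable.hasChicanes (h : HereditarilyIndecomposable Y) :
    HasChicanes (Closeds Y) := by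
  intro a b c d hab hac hbd
  have disj : ∀ {s t : Closeds Y}, s ⊓ t = ⊥ → Disjoint (s : Set Y) t := fun {s t} hst =>
    Set.disjoint_iff_inter_eq_empty.2 (congrArg (fun e : Closeds Y => (e : Set Y)) hst)
  obtain ⟨U, hU, haU, hUc⟩ := normal_exists_closure_subset a.isClosed
    (c.isClosed.union b.isClosed).isOpen_compl
    (Set.subset_compl_iff_disjoint_right.2 (Set.disjoint_union_right.2 ⟨disj hac, disj hab⟩))
  obtain ⟨V, hV, hbV, hVd⟩ := normal_exists_closure_subset b.isClosed
    (d.isClosed.union a.isClosed).isOpen_compl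
    (Set.subset_compl_iff_disjoint_right.2
      (Set.disjoint_union_right.2 ⟨disj hbd, (disj hab).symm⟩))
  obtain ⟨P, Q, hP, hQ, haP, hbQ, hPQ⟩ := h.exists_disjoint_isClopen hV.isClosed_compl
    hU.isClosed_compl a.isClosed b.isClosed
    (Set.disjoint_left.2 fun x hx hx' => hx' (haU hx))
    (Set.disjoint_left.2 fun x hx hx' => hx' (hbV hx))
  have hF := hV.isClosed_compl.isClosedMap_subtype_val _ hP.1
  have hH := hU.isClosed_compl.isClosedMap_subtype_val _ hQ.1
  have hFG := inter_closure_compl_subset_closure P hP rfl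
  have hHG := inter_closure_compl_subset_closure Q hQ rfl
  set F : Set Y := Subtype.val '' P
  set H : Set Y := Subtype.val '' Q
  have eq_bot : ∀ s : Closeds Y, (∀ x, x ∉ s) → s = ⊥ := fun s hs =>
    SetLike.coe_injective (Set.eq_empty_of_forall_notMem hs)
  refine ⟨⟨F, hF⟩, ⟨closure (F ∪ H)ᶜ, isClosed_closure⟩, ⟨H, hH⟩, ?_, fun x hx => ?_,
    fun x hx => ?_, ?_, eq_bot _ ?_, eq_bot _ ?_⟩
  · refine SetLike.coe_injective (Set.eq_univ_of_forall fun x => ?_)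
    by_cases hx : x ∈ F ∪ H
    · exact hx.elim (fun h => .inl (.inl h)) .inr
    · exact .inl (.inr (subset_closure hx))
  · exact ⟨⟨x, fun hxV => hVd (subset_closure hxV) (.inr hx)⟩, haP hx, rfl⟩
  · exact ⟨⟨x, fun hxU => hUc (subset_closure hxU) (.inr hx)⟩, hbQ hx, rfl⟩
  · exact SetLike.coe_injective hPQ.inter_eq
  · rintro x ⟨⟨hxF, hxG⟩, hxd⟩
    exact hVd (hFG ⟨hxF, closure_mono (Set.compl_subset_compl.2 Set.subset_union_left) hxG⟩)
      (.inl hxd)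
  · rintro x ⟨⟨hxG, hxH⟩, hxc⟩
    exact hUc (hHG ⟨hxH, closure_mono (Set.compl_subset_compl.2 Set.subset_union_right) hxG⟩)
      (.inl hxc)

end HereditarilyIndecomposable

theorem IsPreconnected.subset_of_disjoint_isClosed {Z : Type*} [TopologicalSpace Z]
    {C F G : Set Z} (hC : IsPreconnected C) (hF : IsClosed F) (hG : IsClosed G)
    (hCFG : C ⊆ F ∪ G) (hdisj : C ∩ (F ∩ G) = ∅) (hne : (C ∩ F).Nonempty) : C ⊆ F := by
  rcases isPreconnected_iff_subset_of_disjoint_closed.1 hC F G hF hG hCFG hdisj with h | h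
  · exact h
  · obtain ⟨x, hxC, hxF⟩ := hne
    exact absurd hdisj (Set.Nonempty.ne_empty ⟨x, hxC, hxF, h hxC⟩)

/-- If neither continuum contains the other, choose `p ∈ C \ E`, `q ∈ E \ C`, and basic closed sets
`c ⊇ E` missing `p` and `d ⊇ C` missing `q`. In a crooked division, `C` cannot leave `x` because `x`
and `y` are disjoint on `d`; likewise `E` cannot leave `z`. As `x` and `z` are disjoint, so are `C`
and `E`. -/
theorem WallmanSpace.hereditarilyIndecomposable {L : Type u} [DistribLattice L] [BoundedOrder L]
    [T2Space (WallmanSpace L)] (hL : HasChicanes L) :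
    HereditarilyIndecomposable (WallmanSpace L) := by
  intro C E hC hE hCE
  by_contra! hne
  obtain ⟨p, hpC, hpE⟩ := Set.not_subset.1 hne.1
  obtain ⟨q, hqE, hqC⟩ := Set.not_subset.1 hne.2
  obtain ⟨c, hpc, hEc⟩ := exists_closedsHom_of_notMem hE.1.isClosed hpE
  obtain ⟨d, hqd, hCd⟩ := exists_closedsHom_of_notMem hC.1.isClosed hqC
  obtain ⟨a, ha, hca⟩ := p.exists_inf_eq_bot hpc
  obtain ⟨b, hb, hdb⟩ := q.exists_inf_eq_bot hqd
  obtain ⟨a', ha', b', hb', hab'⟩ := exists_inf_eq_bot_of_ne (p := p) (q := q)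
    fun h => hqC (h ▸ hpC)
  obtain ⟨x, y, z, hxyz, hax, hbz, hxz, hxyd, hyzc⟩ := hL (a ⊓ a') (b ⊓ b') c d
    (le_bot_iff.1 ((inf_le_inf inf_le_right inf_le_right).trans hab'.le))
    (le_bot_iff.1 (((inf_le_inf_right c inf_le_left).trans (inf_comm a c).le).trans hca.le))
    (le_bot_iff.1 (((inf_le_inf_right d inf_le_left).trans (inf_comm b d).le).trans hdb.le))
  have hcov : ∀ r : WallmanSpace L, (x ∈ r.1 ∨ y ∈ r.1) ∨ z ∈ r.1 := fun r => by
    rw [← sup_mem_iff, ← sup_mem_iff, hxyz]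
    exact r.top_mem
  have hCx : C ⊆ basicClosed x := by
    refine hC.2.isPreconnected.subset_of_disjoint_isClosed (isClosed_basicClosed x)
      (isClosed_basicClosed (y ⊔ z)) (fun r _ => ?_) ?_
      ⟨p, hpC, p.2.1.mem_of_le _ (p.2.1.inf_mem _ ha _ ha') _ hax⟩
    · rcases hcov r with (h | h) | h
      · exact .inl h
      · exact .inr (r.sup_mem_iff.2 (.inl h))
      · exact .inr (r.sup_mem_iff.2 (.inr h))
    · refine Set.eq_empty_of_forall_notMem fun r hr => ?_
      rcases r.sup_mem_iff.1 hr.2.2 with h | h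
      · exact r.inf_ne_bot (r.2.1.inf_mem _ hr.2.1 _ h) (hCd hr.1) hxyd
      · exact r.inf_ne_bot hr.2.1 h hxz
  have hEz : E ⊆ basicClosed z := by
    refine hE.2.isPreconnected.subset_of_disjoint_isClosed (isClosed_basicClosed z)
      (isClosed_basicClosed (x ⊔ y)) (fun r _ => ?_) ?_
      ⟨q, hqE, q.2.1.mem_of_le _ (q.2.1.inf_mem _ hb _ hb') _ hbz⟩
    · rcases hcov r with h | h
      · exact .inr (r.sup_mem_iff.2 h)
      · exact .inl h
    · refine Set.eq_empty_of_forall_notMem fun r hr => ?_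
      rcases r.sup_mem_iff.1 hr.2.2 with h | h
      · exact r.inf_ne_bot h hr.2.1 hxz
      · exact r.inf_ne_bot (r.2.1.inf_mem _ h _ hr.2.1) (hEc hr.1) hyzc
  obtain ⟨r, hrC, hrE⟩ := hCE
  exact r.inf_ne_bot (hCx hrC) (hEz hrE) hxz

/-! ## Covering dimension -/

/-- The condition that bounds the covering dimension by `m - 1`, in terms of closed sets. -/
def HasSwellings (X : Type*) [TopologicalSpace X] (m : ℕ) : Prop :=
  ∀ (k : ℕ) (a : Fin k → Closeds X), Finset.univ.inf a = ⊥ → ∃ b, IsSwelling m a b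

/-- The condition in the definition of `coveringDim`. -/
def HasRefinements (X : Type*) [TopologicalSpace X] (d : WithBot ℕ∞) : Prop :=
  ∀ U : Set (Set X), IsFiniteOpenCover U →
    ∃ V : Set (Set X), IsFiniteOpenCover V ∧ (∀ s ∈ V, ∃ t ∈ U, s ⊆ t) ∧
      ∀ x : X, (({s ∈ V | x ∈ s}.encard : ℕ∞) : WithBot ℕ∞) ≤ d

theorem Closeds.finset_inf_eq_bot_iff {X ι : Type*} [TopologicalSpace X] [Fintype ι]
    {a : ι → Closeds X} : Finset.univ.inf a = ⊥ ↔ ∀ x, ∃ i, x ∉ a i := by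
  rw [← SetLike.coe_set_eq, Closeds.coe_finset_inf, Closeds.coe_bot, Finset.inf_eq_iInf,
    Set.eq_empty_iff_forall_notMem]
  simp

theorem Closeds.finset_sup_eq_top_iff {X ι : Type*} [TopologicalSpace X] {s : Finset ι}
    {a : ι → Closeds X} : s.sup a = ⊤ ↔ ∀ x, ∃ i ∈ s, x ∈ a i := by
  rw [← SetLike.coe_set_eq, Closeds.coe_finset_sup, Closeds.coe_top, Finset.sup_eq_iSup,
    Set.eq_univ_iff_forall]
  simp

theorem hasRefinements_iff_hasSwellings {X : Type*} [TopologicalSpace X] {m : ℕ} :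
    HasRefinements X ((m : ℕ∞) : WithBot ℕ∞) ↔ HasSwellings X m := by
  classical
  constructor
  · intro h k a ha
    rw [Closeds.finset_inf_eq_bot_iff] at ha
    obtain ⟨V, ⟨hVf, hVo, hVc⟩, hVU, hVm⟩ := h (Set.range fun i => (a i : Set X)ᶜ)
      ⟨Set.finite_range _, by
        rintro _ ⟨i, rfl⟩
        exact (a i).isClosed.isOpen_compl, Set.eq_univ_of_forall fun x =>
          let ⟨i, hi⟩ := ha x
          ⟨_, ⟨i, rfl⟩, hi⟩⟩
    have : ∀ s : V, ∃ i, (s : Set X) ⊆ (a i : Set X)ᶜ := fun s => by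
      obtain ⟨_, ⟨i, rfl⟩, hi⟩ := hVU s s.2
      exact ⟨i, hi⟩
    choose j hj using this
    -- Each member of the refinement is assigned to one index and members with the same index are
    -- merged, so `m + 1` merged sets through `x` come from `m + 1` distinct members.
    refine ⟨fun i => ⟨(⋃ (s : V) (_ : j s = i), (s : Set X))ᶜ,
      (isOpen_iUnion fun s : V => isOpen_iUnion fun _ => hVo s s.2).isClosed_compl⟩,
      fun i x hx hx' => ?_, Closeds.finset_inf_eq_bot_iff.2 fun x => ?_,
      fun S hS => Closeds.finset_sup_eq_top_iff.2 fun x => ?_⟩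
    · obtain ⟨s, rfl, hs⟩ := Set.mem_iUnion₂.1 hx'
      exact hj s hs hx
    · obtain ⟨s, hs, hxs⟩ : x ∈ ⋃₀ V := hVc ▸ Set.mem_univ x
      exact ⟨j ⟨s, hs⟩, fun hx => hx (Set.mem_iUnion₂.2 ⟨⟨s, hs⟩, rfl, hxs⟩)⟩
    · by_contra! hx
      have h1 : ∀ i ∈ S, ∃ s : V, j s = i ∧ x ∈ (s : Set X) := fun i hi => by
        obtain ⟨s, hs, hxs⟩ := Set.mem_iUnion₂.1 (not_not.1 (hx i hi))
        exact ⟨s, hs, hxs⟩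
      have : Nonempty V :=
        let ⟨s, hs, _⟩ : x ∈ ⋃₀ V := hVc ▸ Set.mem_univ x
        ⟨⟨s, hs⟩⟩
      choose! t ht htx using h1
      have h2 : ((fun i => (t i : Set X)) '' (S : Set (Fin k))).encard = (m + 1 : ℕ) := by
        rw [Set.InjOn.encard_image, Set.encard_coe_eq_coe_finsetCard, hS]
        intro i hi i' hi' hii
        rw [← ht i hi, ← ht i' hi', Subtype.ext hii]
      have h3 : ((fun i => (t i : Set X)) '' (S : Set (Fin k))) ⊆ {s ∈ V | x ∈ s} := by
        rintro _ ⟨i, hi, rfl⟩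
        exact ⟨(t i).2, htx i hi⟩
      have h4 := (Set.encard_le_encard h3).trans (WithBot.coe_le_coe.1 (hVm x))
      rw [h2] at h4
      exact absurd (Nat.cast_le.1 h4) (by omega)
  · rintro h U ⟨hUf, hUo, hUc⟩
    obtain ⟨k, e, he⟩ := hUf.fin_param
    have hmem : ∀ i, e i ∈ U := fun i => he.2 ▸ Set.mem_range_self i
    obtain ⟨b, hab, hb, hbm⟩ := h k (fun i => ⟨(e i)ᶜ, (hUo _ (hmem i)).isClosed_compl⟩)
      (Closeds.finset_inf_eq_bot_iff.2 fun x => by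
        obtain ⟨s, hs, hxs⟩ : x ∈ ⋃₀ U := hUc ▸ Set.mem_univ x
        rw [← he.2] at hs
        obtain ⟨i, rfl⟩ := hs
        exact ⟨i, fun hx => hx hxs⟩)
    rw [Closeds.finset_inf_eq_bot_iff] at hb
    refine ⟨Set.range fun i => (b i : Set X)ᶜ, ⟨Set.finite_range _, by
      rintro _ ⟨i, rfl⟩
      exact (b i).isClosed.isOpen_compl, Set.eq_univ_of_forall fun x =>
        let ⟨i, hi⟩ := hb x
        ⟨_, ⟨i, rfl⟩, hi⟩⟩, ?_, fun x => ?_⟩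
    · rintro _ ⟨i, rfl⟩
      exact ⟨e i, hmem i, Set.compl_subset_comm.1 (hab i)⟩
    · rw [WithBot.coe_le_coe]
      have h1 : {s ∈ Set.range fun i => (b i : Set X)ᶜ | x ∈ s} ⊆
          (fun i => (b i : Set X)ᶜ) '' (Finset.univ.filter fun i => x ∉ b i : Finset (Fin k)) := by
        rintro _ ⟨⟨i, rfl⟩, hx⟩
        exact ⟨i, by simpa using hx, rfl⟩
      refine (Set.encard_le_encard h1).trans ((Set.encard_image_le _ _).trans ?_)
      rw [Set.encard_coe_eq_coe_finsetCard, Nat.cast_le]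
      by_contra! hlt
      obtain ⟨S, hS, hSm⟩ := Finset.exists_subset_card_eq (Nat.succ_le_of_lt hlt)
      obtain ⟨i, hi, hxi⟩ := Closeds.finset_sup_eq_top_iff.1 (hbm S hSm) x
      exact (Finset.mem_filter.1 (hS hi)).2 hxi

theorem hasRefinements_top (X : Type*) [TopologicalSpace X] : HasRefinements X ⊤ :=
  fun U hU => ⟨U, hU, fun s hs => ⟨s, hs, subset_rfl⟩, fun _ => le_top⟩

theorem hasRefinements_bot_iff {X : Type*} [TopologicalSpace X] :
    HasRefinements X ⊥ ↔ IsEmpty X := by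
  refine ⟨fun h => ⟨fun x => ?_⟩, fun _ U hU =>
    ⟨U, hU, fun s hs => ⟨s, hs, subset_rfl⟩, fun x => isEmptyElim x⟩⟩
  obtain ⟨V, -, -, hV⟩ := h {Set.univ} ⟨Set.finite_singleton _, by simp, by simp⟩
  exact WithBot.coe_ne_bot (le_bot_iff.1 (hV x))

theorem coveringDim_congr {X : Type*} {Z : Type*} [TopologicalSpace X] [TopologicalSpace Z]
    (he : IsEmpty X ↔ IsEmpty Z) (h : ∀ m, HasSwellings X m ↔ HasSwellings Z m) :
    coveringDim X = coveringDim Z := by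
  refine congrArg sInf (Set.ext fun d => ?_)
  change HasRefinements X (d + 1) ↔ HasRefinements Z (d + 1)
  -- The bound `e` on the order is `⊥` (emptiness), `⊤` (no condition) or a natural number
  -- (swellings).
  generalize d + 1 = e
  induction e with
  | bot => rw [hasRefinements_bot_iff, hasRefinements_bot_iff, he]
  | coe e =>
    induction e with
    | top => exact iff_of_true (hasRefinements_top X) (hasRefinements_top Z)
    | coe m =>
      exact hasRefinements_iff_hasSwellings.trans ((h m).trans hasRefinements_iff_hasSwellings.symm)

namespace ElementarySublattice

variable {Y : Type u} [TopologicalSpace Y] [CompactSpace Y] [T2Space Y] (D : ElementarySublattice Y)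

theorem hasSwellings_wallman_iff {m : ℕ} :
    HasSwellings (WallmanSpace D) m ↔ HasSwellings Y m := by
  have : CompactSpace (WallmanSpace D) := D.compactSpace_wallman
  constructor
  · intro h k
    by_contra! hne
    obtain ⟨a, ha, hb⟩ := D.exists_not_isSwelling hne
    obtain ⟨B, haB, hB, hBm⟩ := h k (fun i => WallmanSpace.closedsHom (a i)) (by
      have := map_finset_inf (WallmanSpace.closedsHom (L := D)) Finset.univ a
      rw [ha, map_bot] at this
      exact this.symm)
    obtain ⟨c, hBc, hc⟩ := WallmanSpace.exists_le_closedsHom B hB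
    have heq : ∀ i, WallmanSpace.closedsHom (a i ⊔ c i) = WallmanSpace.closedsHom (c i) :=
      fun i => by rw [map_sup, sup_eq_right.2 ((haB i).trans (hBc i))]
    -- Joining with `a i` secures the inequality in `D` itself and leaves the image of `c i`
    -- unchanged.
    refine hb (fun i => a i ⊔ c i) ⟨fun i => le_sup_left, D.eq_bot_of_closedsHom ?_,
      fun S hS => D.eq_top_of_closedsHom ?_⟩
    · rw [map_finset_inf, ← hc]
      exact congrArg _ (funext heq)
    · rw [map_finset_sup, eq_top_iff, ← hBm S hS]
      exact Finset.sup_mono_fun fun i _ => (hBc i).trans (heq i).ge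
  · intro h k A hA
    obtain ⟨c, hAc, hc⟩ := WallmanSpace.exists_le_closedsHom A hA
    have hc' : Finset.univ.inf c = ⊥ :=
      D.eq_bot_of_closedsHom ((map_finset_inf WallmanSpace.closedsHom Finset.univ c).trans hc)
    obtain ⟨b, hcb, hb, hbm⟩ := D.exists_isSwelling c (m := m)
      (h k _ ((D.coe_finset_inf _ c).symm.trans (congrArg Subtype.val hc')))
    refine ⟨fun i => WallmanSpace.closedsHom (b i),
      fun i => (hAc i).trans (OrderHomClass.mono WallmanSpace.closedsHom (hcb i)), ?_,
      fun S hS => ?_⟩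
    · have := map_finset_inf (WallmanSpace.closedsHom (L := D)) Finset.univ b
      rw [hb, map_bot] at this
      exact this.symm
    · have := map_finset_sup (WallmanSpace.closedsHom (L := D)) S b
      rw [hbm S hS, map_top] at this
      exact this.symm

theorem coveringDim_wallman : coveringDim (WallmanSpace D) = coveringDim Y :=
  coveringDim_congr
    ⟨fun _ => ⟨fun y => isEmptyElim (D.toWallman y)⟩,
      fun _ => ⟨fun p => isEmptyElim (D.surjective_toWallman p).choose⟩⟩
    fun _ => D.hasSwellings_wallman_iff

end ElementarySublattice

/-! ## Weight -/

theorem exists_isTopologicalBasis_mk_eq_topWeight (X : Type u) [TopologicalSpace X] :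
    ∃ B : Set (Set X), IsTopologicalBasis B ∧ #B = topWeight X :=
  csInf_mem (s := {c | ∃ B : Set (Set X), IsTopologicalBasis B ∧ #B = c})
    ⟨_, {U | IsOpen U}, isTopologicalBasis_opens, rfl⟩

theorem topWeight_le {X : Type u} [TopologicalSpace X] {B : Set (Set X)}
    (hB : IsTopologicalBasis B) : topWeight X ≤ #B :=
  csInf_le' ⟨B, hB, rfl⟩

/-- In a `T₀` space a point is determined by the basic sets containing it. -/
theorem TopologicalSpace.IsTopologicalBasis.infinite {X : Type u} [TopologicalSpace X] [T0Space X]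
    [Infinite X] {B : Set (Set X)} (hB : IsTopologicalBasis B) : Infinite B := by
  by_contra hfin
  rw [not_infinite_iff_finite] at hfin
  refine not_finite_iff_infinite.2 ‹Infinite X›
    (Finite.of_injective (fun x : X => {b : B | x ∈ (b : Set X)}) fun x y hxy => ?_)
  exact (hB.inseparable_iff.2 fun s hs =>
    (Set.ext_iff.1 hxy ⟨s, hs⟩ : x ∈ s ↔ y ∈ s)).eq

theorem aleph0_le_topWeight (X : Type u) [TopologicalSpace X] [T0Space X] [Infinite X] :
    ℵ₀ ≤ topWeight X := by
  obtain ⟨B, hB, h⟩ := exists_isTopologicalBasis_mk_eq_topWeight X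
  have := hB.infinite
  exact h ▸ aleph0_le_mk B

/-- A continuous map of a compact space onto a Hausdorff space does not raise infinite weight. -/
theorem lift_topWeight_le_of_surjective {Z : Type u} {X : Type v} [TopologicalSpace Z]
    [CompactSpace Z] [T0Space Z] [Infinite Z] [TopologicalSpace X] [T2Space X] {h : Z → X}
    (hc : Continuous h) (hs : Function.Surjective h) :
    Cardinal.lift.{u} (topWeight X) ≤ Cardinal.lift.{v} (topWeight Z) := by
  obtain ⟨B, hB, hBw⟩ := exists_isTopologicalBasis_mk_eq_topWeight Z
  have := hB.infinite
  -- `G F` is the set of points whose fibre lies in the union of `F`; it is open because `h` is a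
  -- closed map, and compact fibres make finite `F` enough.
  let G : Finset B → Set X := fun F => (h '' (⋃ b ∈ F, (b : Set Z))ᶜ)ᶜ
  have hG : IsTopologicalBasis (Set.range G) := by
    refine isTopologicalBasis_of_isOpen_of_nhds ?_ fun x U hxU hU => ?_
    · rintro _ ⟨F, rfl⟩
      exact (hc.isClosedMap _ (isOpen_biUnion fun b _ =>
        hB.isOpen b.2).isClosed_compl).isOpen_compl
    · obtain ⟨t, ht⟩ := (isClosed_singleton.preimage hc : IsClosed (h ⁻¹' {x})).isCompact
        |>.elim_finite_subcover (fun b : {b : B // (b : Set Z) ⊆ h ⁻¹' U} => (b.1 : Set Z))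
        (fun b => hB.isOpen b.1.2) (fun z hz => by
          obtain ⟨b, hb, hzb, hbU⟩ := hB.exists_subset_of_mem_open
            (Set.mem_preimage.2 ((Set.mem_singleton_iff.1 hz : h z = x).symm ▸ hxU)) (hU.preimage hc)
          exact Set.mem_iUnion.2 ⟨⟨⟨b, hb⟩, hbU⟩, hzb⟩)
      refine ⟨_, ⟨t.map (Function.Embedding.subtype _), rfl⟩, ?_, ?_⟩
      · rintro ⟨z, hz, hzx⟩
        obtain ⟨b, hb, hzb⟩ := Set.mem_iUnion₂.1 (ht hzx)
        exact hz (Set.mem_iUnion₂.2 ⟨b.1, Finset.mem_map_of_mem _ hb, hzb⟩)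
      · intro x' hx'
        obtain ⟨z, rfl⟩ := hs x'
        by_contra hzU
        refine hx' ⟨z, fun hz => ?_, rfl⟩
        obtain ⟨b, hb, hzb⟩ := Set.mem_iUnion₂.1 hz
        obtain ⟨b, -, rfl⟩ := Finset.mem_map.1 hb
        exact hzU (b.2 hzb)
  calc Cardinal.lift.{u} (topWeight X) ≤ Cardinal.lift.{u} #(Set.range G) :=
        lift_le.2 (topWeight_le hG)
    _ ≤ Cardinal.lift.{v} #(Finset B) := mk_range_le_lift
    _ = Cardinal.lift.{v} (topWeight Z) := by rw [mk_finset_of_infinite, hBw]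

/-! ## Small elementary sublattices -/

theorem card_latticeLanguage_le : latticeLanguage.card ≤ ℵ₀ := by
  have hf : ∀ n, Countable (latticeLanguage.Functions n) := fun n => by
    change Countable (LatticeFunc n)
    refine ⟨fun x => match x with
      | .bot => 0
      | .top => 1
      | .inf => 0
      | .sup => 1, fun a b h => ?_⟩
    cases a <;> cases b <;> simp_all
  have hr : ∀ n, Countable (latticeLanguage.Relations n) := fun n =>
    inferInstanceAs (Countable Empty)
  have : Countable latticeLanguage.Symbols :=
    inferInstanceAs (Countable ((Σ l, latticeLanguage.Functions l) ⊕
      Σ l, latticeLanguage.Relations l))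
  exact mk_le_aleph0

theorem ElementarySublattice.exists_superset_lift_mk_le {Y : Type u} [TopologicalSpace Y]
    (s : Set (Closeds Y)) (κ : Cardinal.{v}) (hκ : ℵ₀ ≤ κ)
    (hs : Cardinal.lift.{v} #s ≤ Cardinal.lift.{u} κ) :
    ∃ D : ElementarySublattice Y, s ⊆ D ∧ Cardinal.lift.{v} #D ≤ Cardinal.lift.{u} κ := by
  rcases le_total (Cardinal.lift.{u} κ) (Cardinal.lift.{v} #(Closeds Y)) with h | h
  · obtain ⟨D, hsD, hD⟩ := Language.exists_elementarySubstructure_card_eq latticeLanguage s κ hκ hs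
      ((lift_le.2 card_latticeLanguage_le).trans (by simpa using hκ)) h
    exact ⟨D, hsD, hD.le⟩
  -- When the whole lattice has size at most `κ`, it serves as `D`.
  · exact ⟨⊤, fun _ _ => trivial, (lift_le.2 (mk_subtype_le _)).trans h⟩

theorem ElementarySublattice.topWeight_wallman_le {Y : Type u} [TopologicalSpace Y]
    (D : ElementarySublattice Y) : topWeight (WallmanSpace D) ≤ #D :=
  (topWeight_le WallmanSpace.isTopologicalBasis_compl_basicClosed).trans mk_range_le

/-- If `D` contains the preimages of the closures of the members of a base, then the fibres of
`D.toWallman` refine those of `f`. -/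
theorem ElementarySublattice.eq_of_toWallman_eq {Y : Type u} {X : Type v} [TopologicalSpace Y]
    [NormalSpace Y] [TopologicalSpace X] [T25Space X] {f : Y → X} (hf : Continuous f)
    (D : ElementarySublattice Y) {B : Set (Set X)} (hB : IsTopologicalBasis B)
    (hD : ∀ b ∈ B, (⟨f ⁻¹' closure b, isClosed_closure.preimage hf⟩ : Closeds Y) ∈ D) {y z : Y}
    (h : D.toWallman y = D.toWallman z) : f y = f z := by
  by_contra hne
  obtain ⟨U, hyU, hU, V, hzV, hV, hUV⟩ := exists_open_nhds_disjoint_closure hne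
  obtain ⟨b, hb, hyb, hbU⟩ := hB.exists_subset_of_mem_open hyU hU
  obtain ⟨c, hc, hzc, hcV⟩ := hB.exists_subset_of_mem_open hzV hV
  have h1 := D.mem_toWallman_of_mem (a := ⟨_, hD b hb⟩) (y := y) (subset_closure hyb)
  have h2 := D.mem_toWallman_of_mem (a := ⟨_, hD c hc⟩) (y := z) (subset_closure hzc)
  rw [h] at h1
  exact (D.toWallman z).inf_ne_bot h1 h2 (D.inf_eq_bot_iff.2 fun w hw hw' =>
    Set.disjoint_left.1 hUV (closure_mono hbU hw) (closure_mono hcV hw'))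

theorem WeaklyConfluent.of_comp {Y Z : Type u} {X : Type v} [TopologicalSpace Y]
    [TopologicalSpace Z] [TopologicalSpace X] {g : Y → Z} {h : Z → X} (hg : Continuous g)
    (hgh : WeaklyConfluent (h ∘ g)) : WeaklyConfluent h := by
  intro C hC
  obtain ⟨K, hK, rfl⟩ := hgh C hC
  exact ⟨g '' K, ⟨hK.1.image hg, hK.2.image g hg.continuousOn⟩, (Set.image_comp h g K).symm⟩

theorem mainTheorem8 {Y : Type u} {X : Type v} [TopologicalSpace Y] [CompactSpace Y] [T2Space Y]
    [TopologicalSpace X] [CompactSpace X] [T2Space X] (f : Y → X) (hf : Continuous f)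
    (hsurj : Function.Surjective f) :
    ∃ (D : ElementarySublattice Y) (g : Y → WallmanSpace D) (h : WallmanSpace D → X),
      CompactSpace (WallmanSpace D) ∧ T2Space (WallmanSpace D) ∧
      Continuous g ∧ Function.Surjective g ∧
      Continuous h ∧ Function.Surjective h ∧
      f = h ∘ g ∧
      (Infinite X →
        Cardinal.lift.{v} (topWeight (WallmanSpace D)) = Cardinal.lift.{u} (topWeight X)) ∧
      (Finite X → topWeight (WallmanSpace D) ≤ ℵ₀) ∧
      (HereditarilyIndecomposable Y → HereditarilyIndecomposable (WallmanSpace D)) ∧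
      coveringDim (WallmanSpace D) = coveringDim Y ∧
      (WeaklyConfluent f → WeaklyConfluent h) := by
  obtain ⟨B, hB, hBw⟩ := exists_isTopologicalBasis_mk_eq_topWeight X
  let a : B → Closeds Y := fun b => ⟨f ⁻¹' closure (b : Set X), isClosed_closure.preimage hf⟩
  obtain ⟨D, haD, hDκ⟩ := ElementarySublattice.exists_superset_lift_mk_le (Set.range a)
    -- Löwenheim–Skolem needs an infinite bound; the maximum is `topWeight X` for infinite `X` and
    -- `ℵ₀` for finite `X`.
    (max ℵ₀ (topWeight X)) (le_max_left _ _)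
    (mk_range_le_lift.trans (lift_le.2 (hBw.trans_le (le_max_right _ _))))
  have hC : CompactSpace (WallmanSpace D) := D.compactSpace_wallman
  have hT : T2Space (WallmanSpace D) := D.t2Space_wallman
  have hg := D.continuous_toWallman
  have hgs := D.surjective_toWallman
  have hfib : ∀ {y z}, D.toWallman y = D.toWallman z → f y = f z := fun {y z} =>
    D.eq_of_toWallman_eq hf hB fun b hb => haD ⟨⟨b, hb⟩, rfl⟩
  let h : WallmanSpace D → X := f ∘ Function.surjInv hgs
  have hfh : f = h ∘ D.toWallman :=
    funext fun y => hfib (Function.surjInv_eq hgs (D.toWallman y)).symm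
  have hh : Continuous h := by
    -- From compact to Hausdorff, `D.toWallman` is closed and hence a quotient map.
    rw [(hg.isClosedMap.isQuotientMap hg hgs).continuous_iff, ← hfh]
    exact hf
  have hhs : Function.Surjective h := fun x => by
    obtain ⟨y, rfl⟩ := hsurj x
    exact ⟨D.toWallman y, (congrFun hfh y).symm⟩
  have hw := (lift_le.{v}.2 D.topWeight_wallman_le).trans hDκ
  refine ⟨D, D.toWallman, h, hC, hT, hg, hgs, hh, hhs, hfh, fun _ => ?_, fun _ => ?_,
    fun hY => WallmanSpace.hereditarilyIndecomposable (D.hasChicanes hY.hasChicanes),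
    D.coveringDim_wallman, fun hfw => WeaklyConfluent.of_comp hg (hfh ▸ hfw)⟩
  · have : Infinite (WallmanSpace D) := Infinite.of_surjective h hhs
    refine le_antisymm ?_ (lift_topWeight_le_of_surjective hh hhs)
    rwa [max_eq_right (aleph0_le_topWeight X)] at hw
  · have : topWeight X ≤ ℵ₀ := by
      rw [← hBw]
      exact mk_le_aleph0
    rw [max_eq_left this, lift_aleph0] at hw
    simpa using hw
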